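/- All vector spaces are over $\mathbb R$. A Fréchet space is a metrizable and complete locally convex space. A strict (LF)-space is a space $E=\bigcup_{n}E_n$, where $E_0\subsetneq E_1\subsetneq\cdots$ are linear subspaces of $E$ carrying Fréchet space topologies $\tau_n$ with $\tau_{n+1}|_{E_n}=\tau_n$ for all $n$, and where $E$ is endowed with the finest locally convex topology $\tau$ such that $\tau|_{E_n}\le\tau_n$ for all $n$. A locally convex space $E$ is a Gâteaux Differentiability Space (GDS) if every continuous convex function $f:D\to\mathbb R$ on a nonempty open convex set $D\subset E$ is Gâteaux differentiable at every point of some dense subset of $D$; here $f$ is Gâteaux differentiable at $x$ if there is a continuous linear functional $L$ on $E$ with $\lim_{s\to0}\frac{f(x+sv)-f(x)}{s}=L(v)$ for all $v\in E$. **Corollary.** No infinite-dimensional strict (LF)-space is a GDS. This applies, for example, to the following spaces: for every $N\ge1$, every nonempty open set $\Omega\subset\mathbb R^N$ and every integer $m\ge0$, the space $D^m(\Omega)$ of $m$ times continuously differentiable real functions with compact support in $\Omega$ and the space $D(\Omega)$ of $C^\infty$ real functions with compact support in $\Omega$ (in particular $D(\mathbb R^N)$), each with its usual topology, the finest locally convex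 topology for which the inclusions of the subspaces of functions supported in a compact set $K\subset\Omega$ (with uniform convergence of the derivatives of order $\le m$, respectively of all orders) are continuous, are infinite-dimensional strict (LF)-spaces, and hence are not GDS. -/

import Mathlib

open scoped Topology Distributions

/-- `t` is a (real) locally convex vector space topology on `F`. -/
structure IsLocallyConvexTopology {F : Type*} [AddCommGroup F] [Module ℝ F]
    (t : TopologicalSpace F) : Prop where
  isTopologicalAddGroup : @IsTopologicalAddGroup F t _
  continuousSMul : @ContinuousSMul ℝ F _ _ t
  locallyConvexSpace : @LocallyConvexSpace ℝ F _ _ _ _ t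

/-- `t` is a Fréchet topology on `F`: a locally convex topology which is metrizable (in particular
Hausdorff) and complete for the uniformity of the topological additive group `(F, t)`. -/
structure IsFrechetTopology {F : Type*} [AddCommGroup F] [Module ℝ F]
    (t : TopologicalSpace F) : Prop extends IsLocallyConvexTopology t where
  metrizable : @TopologicalSpace.MetrizableSpace F t
  complete : @CompleteSpace F
    (@IsTopologicalAddGroup.rightUniformSpace F _ t isTopologicalAddGroup)

/-- The topological space `(E, t)` is the locally convex inductive limit of the sequence
`(S n, τ n)` of linear subspaces of `E`: the `S n` increase and cover `E`, each `τ (n + 1)` induces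
on `S n` a topology coarser than `τ n`, and `t` is the finest locally convex topology on `E`
which induces on each `S n` a topology coarser than `τ n`.
(In Mathlib, `t ≤ t'` means that `t` is finer than `t'`.) -/
structure IsInductiveLimit {E : Type*} [AddCommGroup E] [Module ℝ E]
    (S : ℕ → Submodule ℝ E) (τ : ∀ n, TopologicalSpace (S n)) (t : TopologicalSpace E) : Prop where
  mono : ∀ n, S n ≤ S (n + 1)
  step_le : ∀ n, τ n ≤ (τ (n + 1)).induced (Submodule.inclusion (mono n))
  cover : ∀ x : E, ∃ n, x ∈ S n
  locallyConvex : IsLocallyConvexTopology t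
  le_induced : ∀ n, τ n ≤ t.induced (S n).subtype
  finest : ∀ t' : TopologicalSpace E, IsLocallyConvexTopology t' →
    (∀ n, τ n ≤ t'.induced (S n).subtype) → t ≤ t'

/-- `E` is a strict (LF)-space: it is the locally convex inductive limit of a strictly increasing
sequence of Fréchet spaces `(S n, τ n)` such that `τ (n + 1)` induces on `S n` exactly `τ n`. -/
def IsStrictLF (E : Type*) [AddCommGroup E] [Module ℝ E] [t : TopologicalSpace E] : Prop :=
  ∃ (S : ℕ → Submodule ℝ E) (τ : ∀ n, TopologicalSpace (S n)) (h : IsInductiveLimit S τ t),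
    (∀ n, IsFrechetTopology (τ n)) ∧
    (∀ n, S n < S (n + 1)) ∧
    (∀ n, τ n = (τ (n + 1)).induced (Submodule.inclusion (h.mono n)))

/-- `f` is Gâteaux differentiable at `x`: there is a continuous linear functional `L` such that
`(f (x + s • v) - f x) / s → L v` as `s → 0`, for every direction `v`. -/
def GateauxDifferentiableAt {E : Type*} [AddCommGroup E] [Module ℝ E] [TopologicalSpace E]
    (f : E → ℝ) (x : E) : Prop :=
  ∃ L : E →L[ℝ] ℝ, ∀ v : E, HasLineDerivAt ℝ f (L v) x v

/-- `E` is a Gâteaux differentiability space: every continuous convex real function on a nonempty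
open convex subset `D` of `E` is Gâteaux differentiable at the points of a dense subset of `D`.
(The values of `f` outside the open set `D` play no role.) -/
def IsGDS (E : Type*) [AddCommGroup E] [Module ℝ E] [TopologicalSpace E] : Prop :=
  ∀ (D : Set E) (f : E → ℝ), D.Nonempty → IsOpen D → Convex ℝ D →
    ContinuousOn f D → ConvexOn ℝ D f →
    D ⊆ closure {x ∈ D | GateauxDifferentiableAt f x}

/-!
Why a strict (LF)-space `E`, the inductive limit of the Fréchet steps `S n`, is never a Gâteaux
differentiability space: there is a continuous seminorm on `E` that is Gâteaux differentiable at no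
point at all.

For each `n` there is a continuous linear functional `u n` on `E` that vanishes on `S n` but not on
`S (n + 1)` (`IsInductiveLimit.exists_functional_separating_step`). Indeed `S n`, being complete, is
closed in `S (n + 1)`, so Hahn-Banach gives such a functional on `S (n + 1)`. Because each step
carries the topology induced by the next one, Hahn-Banach also extends it successively to
`S (n + 2)`, `S (n + 3)`, …, and the common extension is continuous since its restriction to every
step is. This way one never needs to know that `E` induces on `S n` its own topology.

Put `p x = ∑ k, |u k x|`. On `S n` only the terms with `k < n` survive, so `p` is a seminorm,
continuous on each step, hence continuous. At a point `x ∈ S n`, choose `v ∈ S (n + 1)` with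
`u n v ≠ 0`. Since `u n x = 0`, the term `|u n (x + s • v)| = |s| |u n v|` has a corner at `s = 0`,
which the other, convex, terms cannot smooth out: the second difference of `p` at `x` along `v` is
at least `2 |s| |u n v|` (`IsStrictLF.not_isGDS`).

The spaces of test functions are strict (LF)-spaces (`TestFunction.isStrictLF`), with steps the
functions supported in the members of a compact exhaustion of `Ω`. Completeness of a step means that
the range of `f ↦ (iteratedFDeriv ℝ i f)ᵢ` is closed for uniform convergence: the uniform limits of
the derivatives form a Taylor series of the limit function. The steps increase strictly along a
subsequence, because `Ω` minus a compact set is nonempty and open, hence contains the support of a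
bump function.
-/

section

open Filter Topology TopologicalSpace

/-! ### Extension and separation by functionals along an inducing linear map -/

theorem LocallyConvexSpace.polynormableSpace {F : Type*} [AddCommGroup F] [Module ℝ F]
    [TopologicalSpace F] [IsTopologicalAddGroup F] [ContinuousSMul ℝ F] [LocallyConvexSpace ℝ F] :
    PolynormableSpace ℝ F :=
  (with_gaugeSeminormFamily (𝕜 := ℝ) (E := F)).toPolynormableSpace

/-- Hahn-Banach: a continuous functional extends along a linear topological embedding. -/
theorem Topology.IsInducing.exists_extend_functional {G F : Type*} [AddCommGroup G] [Module ℝ G]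
    [TopologicalSpace G] [AddCommGroup F] [Module ℝ F]
    [TopologicalSpace F] [IsTopologicalAddGroup F] [ContinuousSMul ℝ F] [LocallyConvexSpace ℝ F]
    {i : G →ₗ[ℝ] F} (hi : IsInducing i) (hinj : Function.Injective i) (f : G →ₗ[ℝ] ℝ)
    (hf : Continuous f) : ∃ g : F →ₗ[ℝ] ℝ, Continuous g ∧ ∀ x, g (i x) = f x := by
  have := LocallyConvexSpace.polynormableSpace (F := F)
  let p : Seminorm ℝ G := (normSeminorm ℝ ℝ).comp f
  have hp : Continuous p := hf.norm
  obtain ⟨q, hq, hpq⟩ := Seminorm.exists_le_comp_of_isInducing hp hi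
  let e := LinearEquiv.ofInjective i hinj
  obtain ⟨g, hg, -⟩ := Module.Dual.exists_continuous_extension_of_le_seminorm_real
    (LinearMap.range i) (f.comp e.symm.toLinearMap) hq (by
      intro x
      obtain ⟨y, rfl⟩ := e.surjective x
      have := hpq y
      simpa [e] using (le_abs_self _).trans this)
  refine ⟨g, g.continuous, fun x => ?_⟩
  simpa [e] using hg (e x)

theorem AddMonoidHom.isUniformInducing_rightUniformSpace {G F : Type*} [AddCommGroup G]
    [AddCommGroup F] [tG : TopologicalSpace G] [tF : TopologicalSpace F] [IsTopologicalAddGroup G]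
    [IsTopologicalAddGroup F] (f : G →+ F) (hf : IsInducing f) :
    @IsUniformInducing G F (IsTopologicalAddGroup.rightUniformSpace G)
      (IsTopologicalAddGroup.rightUniformSpace F) f := by
  let := IsTopologicalAddGroup.rightUniformSpace G
  let := IsTopologicalAddGroup.rightUniformSpace F
  have : IsUniformAddGroup G := isUniformAddGroup_of_addCommGroup
  have : IsUniformAddGroup F := isUniformAddGroup_of_addCommGroup
  exact AddMonoidHom.isUniformInducing_of_isInducing hf

/-- Hahn-Banach: a point outside a complete, hence closed, subspace is separated from it by a
continuous functional. -/
theorem Topology.IsInducing.exists_functional_eq_zero {G F : Type*} [AddCommGroup G] [Module ℝ G]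
    [TopologicalSpace G] [IsTopologicalAddGroup G] [AddCommGroup F] [Module ℝ F]
    [TopologicalSpace F] [IsTopologicalAddGroup F] [ContinuousSMul ℝ F] [LocallyConvexSpace ℝ F]
    [T2Space F] {i : G →ₗ[ℝ] F} (hi : IsInducing i)
    (hG : @CompleteSpace G (IsTopologicalAddGroup.rightUniformSpace G))
    (x : F) (hx : x ∉ LinearMap.range i) :
    ∃ g : F →ₗ[ℝ] ℝ, Continuous g ∧ (∀ y, g (i y) = 0) ∧ g x ≠ 0 := by
  have hcl : IsClosed (LinearMap.range i : Set F) := by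
    have h := AddMonoidHom.isUniformInducing_rightUniformSpace i.toAddMonoidHom hi
    let := IsTopologicalAddGroup.rightUniformSpace G
    let := IsTopologicalAddGroup.rightUniformSpace F
    exact ((completeSpace_iff_isComplete_range h).1 hG).isClosed
  obtain ⟨f, u, hfx, hfu⟩ := geometric_hahn_banach_point_closed
    (Submodule.convex (LinearMap.range i)) hcl hx
  have hu : u < 0 := by simpa using hfu 0 (zero_mem _)
  refine ⟨f, f.continuous, fun y => ?_, (hfx.trans hu).ne⟩
  -- a linear functional bounded below on a subspace vanishes there
  by_contra hy
  have := hfu (((u - 1) / f (i y)) • i y) (Submodule.smul_mem _ _ ⟨y, rfl⟩)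
  rw [map_smul, smul_eq_mul] at this
  have h2 : (u - 1) / f (i y) * f (i y) = u - 1 := div_mul_cancel₀ _ hy
  linarith

/-! ### Continuous functionals on inductive limits -/

section InductiveLimit

variable {E : Type*} [AddCommGroup E] [Module ℝ E] {S : ℕ → Submodule ℝ E}
  {τ : ∀ n, TopologicalSpace (S n)} {t : TopologicalSpace E}

theorem IsInductiveLimit.monotone (h : IsInductiveLimit S τ t) : Monotone S :=
  monotone_nat_of_le_succ h.mono

theorem IsInductiveLimit.continuous_restrict_of_le (h : IsInductiveLimit S τ t) {m n : ℕ}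
    (hmn : m ≤ n) {f : E → ℝ} (hf : @Continuous (S n) ℝ (τ n) _ (fun x => f x)) :
    @Continuous (S m) ℝ (τ m) _ (fun x => f x) := by
  induction n, hmn using Nat.le_induction with
  | base => exact hf
  | succ n hmn ih =>
    refine ih ?_
    have hincl : @Continuous (S n) (S (n + 1)) (τ n) (τ (n + 1))
        (Submodule.inclusion (h.mono n)) := by
      rw [continuous_iff_le_induced]
      exact h.step_le n
    exact hf.comp hincl

theorem IsInductiveLimit.continuous_of_restrict (h : IsInductiveLimit S τ t) (u : E →ₗ[ℝ] ℝ)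
    (hu : ∀ n, @Continuous (S n) ℝ (τ n) _ (fun x => u x)) : @Continuous E ℝ t _ u := by
  rw [continuous_iff_le_induced]
  refine h.finest _ ⟨topologicalAddGroup_induced u, continuousSMul_induced u,
    LocallyConvexSpace.induced u⟩ fun n => ?_
  rw [induced_compose]
  exact continuous_iff_le_induced.1 (hu n)

theorem IsInductiveLimit.continuous_seminorm_of_restrict (h : IsInductiveLimit S τ t)
    (hτ : ∀ n, @IsTopologicalAddGroup (S n) (τ n) _) (p : Seminorm ℝ E)
    (hp : ∀ n, @Continuous (S n) ℝ (τ n) _ (fun x => p x)) : @Continuous E ℝ t _ p := by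
  let N : SeminormedAddCommGroup E := AddGroupSeminorm.toSeminormedAddCommGroup p.toAddGroupSeminorm
  let _ : NormedSpace ℝ E := { norm_smul_le := fun a b => (map_smul_eq_mul p a b).le }
  let t' : TopologicalSpace E := N.toUniformSpace.toTopologicalSpace
  have hle : t ≤ t' := by
    refine h.finest t' ⟨inferInstance, inferInstance, inferInstance⟩ fun n => ?_
    rw [← continuous_iff_le_induced]
    let := τ n
    have := hτ n
    refine continuous_of_continuousAt_zero (S n).subtype ?_
    rw [ContinuousAt, map_zero, tendsto_zero_iff_norm_tendsto_zero]
    have h0 := (hp n).tendsto 0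
    rw [ZeroMemClass.coe_zero, map_zero] at h0
    exact h0
  have hpc : @Continuous E ℝ t' _ p := continuous_norm
  exact continuous_le_dom hle hpc

/-- On a strict inductive limit, a functional which is continuous on one step agrees on that step
with a continuous functional on the whole space. -/
theorem IsInductiveLimit.exists_extend_functional (h : IsInductiveLimit S τ t)
    (hF : ∀ n, IsFrechetTopology (τ n))
    (hstep : ∀ n, τ n = (τ (n + 1)).induced (Submodule.inclusion (h.mono n)))
    {m : ℕ} (u : E →ₗ[ℝ] ℝ) (hu : @Continuous (S m) ℝ (τ m) _ (fun x => u x)) :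
    ∃ v : E →ₗ[ℝ] ℝ, @Continuous E ℝ t _ v ∧ ∀ x ∈ S m, v x = u x := by
  -- functionals on a step are represented by arbitrary linear extensions to `E`, so that the
  -- successive extensions all have the same type
  have step : ∀ n (w : E →ₗ[ℝ] ℝ), @Continuous (S n) ℝ (τ n) _ (fun x => w x) →
      ∃ w' : E →ₗ[ℝ] ℝ, @Continuous (S (n + 1)) ℝ (τ (n + 1)) _ (fun x => w' x) ∧
        ∀ x ∈ S n, w' x = w x := by
    intro n w hw
    let := τ n
    let := τ (n + 1)
    have := (hF (n + 1)).isTopologicalAddGroup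
    have := (hF (n + 1)).continuousSMul
    have := (hF (n + 1)).locallyConvexSpace
    obtain ⟨g, hg, hgw⟩ := IsInducing.exists_extend_functional
      (i := Submodule.inclusion (h.mono n)) ⟨hstep n⟩ (Submodule.inclusion_injective _)
      (w.comp (S n).subtype) hw
    obtain ⟨w', hw'⟩ := LinearMap.exists_extend g
    have key : ∀ x : S (n + 1), w' x = g x := fun x => LinearMap.congr_fun hw' x
    refine ⟨w', by simpa only [key] using hg, fun x hx => ?_⟩
    exact (key ⟨x, h.mono n hx⟩).trans (hgw ⟨x, hx⟩)
  choose! ext hext using step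
  let w : ℕ → E →ₗ[ℝ] ℝ := fun k => Nat.rec u (fun k w => ext (m + k) w) k
  have hwc : ∀ k, @Continuous (S (m + k)) ℝ (τ (m + k)) _ (fun x => w k x) := by
    intro k
    induction k with
    | zero => exact hu
    | succ k ih => exact (hext (m + k) (w k) ih).1
  have hws : ∀ k, ∀ x ∈ S (m + k), w (k + 1) x = w k x :=
    fun k => (hext (m + k) (w k) (hwc k)).2
  have hwl : ∀ k l, k ≤ l → ∀ x ∈ S (m + k), w l x = w k x := by
    intro k l hkl x hx
    induction l, hkl using Nat.le_induction with
    | base => rfl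
    | succ l hkl ih => rw [hws l x (h.monotone (by lia) hx), ih]
  choose N hN using h.cover
  have hN' : ∀ x l, N x ≤ l → w l x = w (N x) x := fun x l hl =>
    hwl _ _ hl x (h.monotone (by lia) (hN x))
  let v : E →ₗ[ℝ] ℝ :=
    { toFun := fun x => w (N x) x
      map_add' := fun x y => by
        have h1 := hN' x (N x + N y + N (x + y)) (by lia)
        have h2 := hN' y (N x + N y + N (x + y)) (by lia)
        have h3 := hN' (x + y) (N x + N y + N (x + y)) (by lia)
        rw [← h1, ← h2, ← h3, map_add]
      map_smul' := fun c x => by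
        have h1 := hN' x (N x + N (c • x)) (by lia)
        have h3 := hN' (c • x) (N x + N (c • x)) (by lia)
        rw [← h1, ← h3, map_smul]; rfl }
  have hv : ∀ k, ∀ x ∈ S (m + k), v x = w k x := by
    intro k x hx
    rw [← hwl k (k + N x) (by lia) x hx]
    exact (hN' x (k + N x) (by lia)).symm
  refine ⟨v, h.continuous_of_restrict v fun n => ?_, fun x hx => hv 0 x hx⟩
  refine h.continuous_restrict_of_le (Nat.le_add_left n m) ?_
  have : (fun x : S (m + n) => v x) = fun x : S (m + n) => w n x :=
    funext fun x => hv n x x.2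
  rw [this]
  exact hwc n

theorem IsInductiveLimit.exists_functional_separating_step (h : IsInductiveLimit S τ t)
    (hF : ∀ n, IsFrechetTopology (τ n)) (hlt : ∀ n, S n < S (n + 1))
    (hstep : ∀ n, τ n = (τ (n + 1)).induced (Submodule.inclusion (h.mono n))) (n : ℕ) :
    ∃ v : E →ₗ[ℝ] ℝ, @Continuous E ℝ t _ v ∧ (∀ x ∈ S n, v x = 0) ∧
      ∃ x ∈ S (n + 1), v x ≠ 0 := by
  obtain ⟨x, hx, hxn⟩ := SetLike.exists_of_lt (hlt n)
  have : ∃ g : S (n + 1) →ₗ[ℝ] ℝ, @Continuous _ _ (τ (n + 1)) _ g ∧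
      (∀ y : S n, g (Submodule.inclusion (h.mono n) y) = 0) ∧ g ⟨x, hx⟩ ≠ 0 := by
    let := τ n
    let := τ (n + 1)
    have := (hF n).isTopologicalAddGroup
    have := (hF (n + 1)).isTopologicalAddGroup
    have := (hF (n + 1)).continuousSMul
    have := (hF (n + 1)).locallyConvexSpace
    have := (hF (n + 1)).metrizable
    refine IsInducing.exists_functional_eq_zero (i := Submodule.inclusion (h.mono n)) ⟨hstep n⟩
      (hF n).complete ⟨x, hx⟩ ?_
    rintro ⟨y, hy⟩
    have hyx : (y : E) = x := congrArg Subtype.val hy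
    exact hxn (hyx ▸ y.2)
  obtain ⟨g, hg, hg0, hgx⟩ := this
  obtain ⟨w, hw⟩ := LinearMap.exists_extend g
  have key : ∀ x : S (n + 1), w x = g x := fun x => LinearMap.congr_fun hw x
  obtain ⟨v, hv, hvw⟩ := h.exists_extend_functional hF hstep (m := n + 1) w
    (by simpa only [key] using hg)
  refine ⟨v, hv, fun y hy => ?_, x, hx, ?_⟩
  · rw [hvw y (h.mono n hy)]
    exact (key ⟨y, h.mono n hy⟩).trans (hg0 ⟨y, hy⟩)
  · rw [hvw x hx]
    exact (key ⟨x, hx⟩).trans_ne hgx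

end InductiveLimit

/-! ### A nowhere differentiable seminorm -/

/-- A function whose symmetric second differences at `x` along `v` are bounded below by `c * |s|`
with `c > 0` has no derivative at `x` along `v`. -/
theorem HasLineDerivAt.false_of_abs_le {E : Type*} [AddCommGroup E] [Module ℝ E] {f : E → ℝ}
    {x v : E} {l c : ℝ} (h : HasLineDerivAt ℝ f l x v) (hc : 0 < c)
    (hle : ∀ s : ℝ, c * |s| ≤ f (x + s • v) + f (x - s • v) - 2 * f x) : False := by
  have h1 : HasDerivAt (fun s : ℝ => f (x + s • v)) l 0 := h
  have h2 : HasDerivAt (fun s : ℝ => f (x + (-s) • v)) (-l) 0 := by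
    have := HasDerivAt.scomp_of_eq (0 : ℝ) h1 (hasDerivAt_neg (0 : ℝ)) (by simp)
    simpa [Function.comp_def] using this
  have h3 : HasDerivAt (fun s : ℝ => f (x + s • v) + f (x + (-s) • v) - 2 * f x) 0 0 := by
    simpa using (h1.add h2).sub_const (2 * f x)
  have h4 := (hasDerivAt_iff_isLittleO.1 h3).def (half_pos hc)
  obtain ⟨s, hs, hs0⟩ := ((h4.filter_mono nhdsWithin_le_nhds).and
    (self_mem_nhdsWithin : {(0 : ℝ)}ᶜ ∈ 𝓝[≠] 0)).exists
  have hpos : 0 < |s| := abs_pos.2 hs0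
  have hh := hle s
  simp only [neg_smul, ← sub_eq_add_neg, neg_zero, zero_smul, sub_zero, add_zero, smul_zero,
    Real.norm_eq_abs] at hs
  have e : f x + f x - 2 * f x = 0 := by ring
  rw [e, sub_zero] at hs
  have := (le_abs_self _).trans hs
  nlinarith [mul_pos hc hpos]

/-- The seminorm `p x = ∑ k, |u k x|` for functionals `u k` vanishing on `S k`: the sum is finite at
every point, and ranges over `k < n` on `S n`. -/
theorem exists_seminorm_eq_sum_abs {E : Type*} [AddCommGroup E] [Module ℝ E]
    {S : ℕ → Submodule ℝ E} (hS : Monotone S) (hcover : ∀ x : E, ∃ n, x ∈ S n)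
    (u : ℕ → E →ₗ[ℝ] ℝ) (hu : ∀ n, ∀ x ∈ S n, u n x = 0) :
    ∃ p : Seminorm ℝ E, ∀ n, ∀ x ∈ S n, p x = ∑ k ∈ Finset.range n, |u k x| := by
  have hz : ∀ n, ∀ x ∈ S n, ∀ k, k ∉ Finset.range n → |u k x| = 0 := by
    intro n x hx k hk
    rw [hu k x (hS (by simpa using hk) hx), abs_zero]
  have hs : ∀ x, Summable fun k => |u k x| := fun x => by
    obtain ⟨n, hn⟩ := hcover x
    exact summable_of_ne_finset_zero (hz n x hn)
  refine ⟨Seminorm.of (fun x => ∑' k, |u k x|) (fun x y => ?_) (fun c x => ?_), fun n x hx => ?_⟩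
  · rw [← (hs x).tsum_add (hs y)]
    refine (hs _).tsum_le_tsum (fun k => ?_) ((hs x).add (hs y))
    rw [map_add]
    exact abs_add_le _ _
  · simp only [map_smul, smul_eq_mul, abs_mul, Real.norm_eq_abs]
    exact tsum_mul_left
  · exact tsum_eq_sum (hz n x hx)

theorem IsStrictLF.not_isGDS {E : Type*} [AddCommGroup E] [Module ℝ E] [t : TopologicalSpace E]
    (hE : IsStrictLF E) : ¬ IsGDS E := by
  obtain ⟨S, τ, h, hF, hlt, hstep⟩ := hE
  choose u huc hu0 v hv huv using h.exists_functional_separating_step hF hlt hstep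
  obtain ⟨p, hp⟩ := exists_seminorm_eq_sum_abs h.monotone h.cover u hu0
  have hpc : Continuous p := by
    refine h.continuous_seminorm_of_restrict (fun n => (hF n).isTopologicalAddGroup) p fun n => ?_
    have : (fun x : S n => p x) = fun x : S n => ∑ k ∈ Finset.range n, |u k x| :=
      funext fun x => hp n x x.2
    rw [this]
    let := τ n
    have hsub : Continuous (S n).subtype := continuous_iff_le_induced.2 (h.le_induced n)
    exact continuous_finsetSum _ fun k _ => ((huc k).comp hsub).abs
  intro hG
  have hd := hG Set.univ p Set.univ_nonempty isOpen_univ convex_univ hpc.continuousOn p.convexOn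
  have hempty : {x ∈ (Set.univ : Set E) | GateauxDifferentiableAt p x} = ∅ := by
    refine Set.eq_empty_of_forall_notMem ?_
    rintro x ⟨-, L, hL⟩
    obtain ⟨n, hn⟩ := h.cover x
    refine (hL (v n)).false_of_abs_le (c := 2 * |u n (v n)|) (by have := huv n; positivity)
      fun s => ?_
    have hx := h.mono n hn
    have hsv := (S (n + 1)).smul_mem s (hv n)
    rw [hp _ _ (add_mem hx hsv), hp _ _ (sub_mem hx hsv), hp _ _ hx]
    have e : 2 * |u n (v n)| * |s| = ∑ k ∈ Finset.range (n + 1),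
        if k = n then 2 * |u n (v n)| * |s| else 0 := by
      simp
    rw [e, Finset.mul_sum, ← Finset.sum_add_distrib, ← Finset.sum_sub_distrib]
    refine Finset.sum_le_sum fun k _ => ?_
    simp only [map_add, map_sub, map_smul, smul_eq_mul]
    split_ifs with hk
    · subst hk
      rw [hu0 _ x hn]
      simp [abs_mul]
      linarith
    · have := abs_add_le (u k x + s * u k (v n)) (u k x - s * u k (v n))
      rw [show u k x + s * u k (v n) + (u k x - s * u k (v n)) = 2 * u k x by ring, abs_mul,
        abs_two] at this
      linarith
  rw [hempty, closure_empty] at hd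
  exact hd (Set.mem_univ 0)

theorem IsStrictLF.not_finiteDimensional {E : Type*} [AddCommGroup E] [Module ℝ E]
    [TopologicalSpace E] (hE : IsStrictLF E) : ¬ FiniteDimensional ℝ E := by
  obtain ⟨S, -, -, -, hlt, -⟩ := hE
  intro _
  exact not_strictMono_of_wellFoundedGT S (strictMono_nat_of_lt_succ hlt)

/-! ### Functions supported in a fixed compact set form a Fréchet space -/

theorem IsFrechetTopology.induced_linearEquiv {F G : Type*} [AddCommGroup F] [Module ℝ F]
    [AddCommGroup G] [Module ℝ G] {t : TopologicalSpace F} (ht : IsFrechetTopology t)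
    (e : G ≃ₗ[ℝ] F) : IsFrechetTopology (t.induced e) := by
  have := ht.isTopologicalAddGroup
  have := ht.continuousSMul
  have := ht.locallyConvexSpace
  have := ht.metrizable
  let t' := t.induced e
  have hind : IsInducing e := ⟨rfl⟩
  have hG : IsTopologicalAddGroup G := topologicalAddGroup_induced e
  refine ⟨⟨hG, continuousSMul_induced e.toLinearMap, LocallyConvexSpace.induced e.toLinearMap⟩,
    (⟨hind, e.injective⟩ : IsEmbedding e).metrizableSpace, ?_⟩
  have hu := AddMonoidHom.isUniformInducing_rightUniformSpace
    (e.toLinearMap.toAddMonoidHom) hind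
  let := IsTopologicalAddGroup.rightUniformSpace G
  let := IsTopologicalAddGroup.rightUniformSpace F
  exact (hu.completeSpace_congr e.surjective).2 ht.complete

namespace ContDiffMapSupportedIn

variable {E F : Type*} [NormedAddCommGroup E] [NormedSpace ℝ E] [NormedAddCommGroup F]
  [NormedSpace ℝ F] {n : ℕ∞} {K : Compacts E}

/-- Passing through an arbitrary metric space `β` makes the topology on the codomain the one of its
metric; instance search does not find this on its own for multilinear maps. -/
instance metrizableSpace_boundedContinuousFunction_multilinear (i : ℕ) :
    MetrizableSpace (BoundedContinuousFunction E (E [×i]→L[ℝ] F)) :=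
  have h (β : Type _) [MetricSpace β] : MetrizableSpace (BoundedContinuousFunction E β) :=
    inferInstance
  h _

/-- If all derivatives of a sequence in `𝓓^{n}_{K}(E, F)` converge uniformly, the limits are the
derivatives of an element of `𝓓^{n}_{K}(E, F)`. -/
theorem isClosed_range_pi_structureMapCLM :
    IsClosed (Set.range (ContinuousLinearMap.pi (structureMapCLM ℝ n) :
      𝓓^{n}_{K}(E, F) →L[ℝ] Π i, BoundedContinuousFunction E (E [×i]→L[ℝ] F))) := by
  refine isClosed_of_closure_subset fun g hg => ?_
  obtain ⟨y, hy, hlim⟩ := mem_closure_iff_seq_limit.1 hg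
  choose f hf using hy
  have hT : ∀ i : ℕ, i ≤ n →
      TendstoUniformly (fun j x => iteratedFDeriv ℝ i (f j) x) (g i) atTop := by
    intro i hi
    have h1 := BoundedContinuousFunction.tendsto_iff_tendstoUniformly.1 (tendsto_pi_nhds.1 hlim i)
    have h2 : (fun j x => iteratedFDeriv ℝ i (f j) x) = fun j => ⇑(y j i) := by
      funext j x
      rw [← hf j]
      simp [structureMapCLM_apply, hi]
    rwa [h2]
  -- the structure maps of order `i > n` are zero by convention
  have hzero : ∀ i : ℕ, ¬ i ≤ n → g i = 0 := by
    intro i hi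
    refine tendsto_nhds_unique (tendsto_pi_nhds.1 hlim i) (tendsto_const_nhds.congr fun j => ?_)
    rw [← hf j]
    ext x
    simp [structureMapCLM_apply, hi]
  -- `g 0 x` is a multilinear map in no variables, evaluated at its only argument
  let φ : E → F := fun x => g 0 x 0
  have hTaylor : HasFTaylorSeriesUpTo n φ fun x i => g i x := by
    refine ⟨fun x => rfl, fun m hm x => ?_, fun m hm => (g m).continuous⟩
    have hm1 : m + 1 ≤ n := by
      have : (m : ℕ∞) < n := by exact_mod_cast hm
      exact Order.add_one_le_of_lt this
    have hm' : (m : ℕ∞) ≤ n := le_self_add.trans hm1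
    refine hasFDerivAt_of_tendstoUniformly (l := atTop) (g' := fun x => (g (m + 1) x).curryLeft)
      (f' := fun j x => (iteratedFDeriv ℝ (m + 1) (f j) x).curryLeft) ?_ (fun j x => ?_)
      (fun x => (hT m hm').tendsto_at x) x
    · exact (continuousMultilinearCurryLeftEquiv ℝ (fun _ : Fin (m + 1) => E)
        F).lipschitz.uniformContinuous.comp_tendstoUniformly (hT (m + 1) (mod_cast hm1))
    · exact ((contDiff_iff_ftaylorSeries.1 (f j).contDiff).fderiv m hm x)
  have hφ : ContDiff ℝ n φ := hTaylor.contDiff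
  have hsupp : Function.support φ ⊆ K := by
    rw [Function.support_subset_iff']
    intro x hx
    have h0 := (hT 0 zero_le).tendsto_at x
    have : g 0 x = 0 := by
      refine tendsto_nhds_unique h0 (tendsto_const_nhds.congr fun j => ?_)
      exact ((f j).iteratedFDeriv_zero_on_compl hx).symm
    simp [φ, this]
  refine ⟨.of_support_subset hφ hsupp, funext fun i => ?_⟩
  by_cases hi : (i : ℕ∞) ≤ n
  · ext1 x
    have := hTaylor.eq_iteratedFDeriv (m := i) (mod_cast hi) x
    simp only [ContinuousLinearMap.coe_pi', structureMapCLM_apply, hi, if_true]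
    exact this.symm
  · ext1 x
    simp [structureMapCLM_apply, hi, hzero]

theorem isFrechetTopology [CompleteSpace F] :
    IsFrechetTopology (inferInstance : TopologicalSpace 𝓓^{n}_{K}(E, F)) := by
  have he := isUniformEmbedding_pi_structureMapCLM ℝ (E := E) (F := F) (n := n) (K := K)
  refine ⟨⟨inferInstance, inferInstance, inferInstance⟩, he.isEmbedding.metrizableSpace, ?_⟩
  have hc : CompleteSpace 𝓓^{n}_{K}(E, F) :=
    (completeSpace_iff_isComplete_range he.isUniformInducing).2
      isClosed_range_pi_structureMapCLM.isComplete
  have hu : (uniformSpace : UniformSpace 𝓓^{n}_{K}(E, F)) =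
      IsTopologicalAddGroup.rightUniformSpace 𝓓^{n}_{K}(E, F) :=
    (IsUniformAddGroup.rightUniformSpace_eq).symm
  rwa [hu] at hc

theorem isInducing_monoCLM {K₁ K₂ : Compacts E} (hK : K₁ ≤ K₂) :
    IsInducing (monoCLM ℝ : 𝓓^{n}_{K₁}(E, F) →L[ℝ] 𝓓^{n}_{K₂}(E, F)) := by
  refine ⟨?_⟩
  simp only [topologicalSpace, induced_iInf, induced_compose]
  congr! 3 with i
  funext f
  ext x
  simp [structureMapLM_apply, hK, monoCLM]

end ContDiffMapSupportedIn

/-! ### Compact exhaustions -/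

theorem Monotone.exists_strictMono_comp {α : Type*} [PartialOrder α] {f : ℕ → α} (hf : Monotone f)
    (h : ∀ n, ∃ m, f n < f m) : ∃ φ : ℕ → ℕ, StrictMono φ ∧ StrictMono (f ∘ φ) := by
  choose g hg using h
  let φ : ℕ → ℕ := fun k => g^[k] 0
  have hφ : ∀ k, φ (k + 1) = g (φ k) := fun k => Function.iterate_succ_apply' g k 0
  refine ⟨φ, strictMono_nat_of_lt_succ fun k => ?_, strictMono_nat_of_lt_succ fun k => ?_⟩
  · rw [hφ]
    exact hf.reflect_lt (hg _)
  · rw [Function.comp_apply, Function.comp_apply, hφ]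
    exact hg _

theorem TopologicalSpace.Opens.exists_compacts_exhaustion {X : Type*} [TopologicalSpace X]
    [LocallyCompactSpace X] [SecondCountableTopology X] (Ω : Opens X) :
    ∃ K : ℕ → Compacts X, Monotone K ∧ (∀ n, (K n : Set X) ⊆ Ω) ∧
      ∀ C : Set X, IsCompact C → C ⊆ Ω → ∃ n, C ⊆ K n := by
  have : LocallyCompactSpace Ω := Ω.isOpen.locallyCompactSpace
  let κ := CompactExhaustion.choice Ω
  refine ⟨fun n => ⟨(↑) '' κ n, (κ.isCompact n).image continuous_subtype_val⟩,
    fun m n hmn => ?_, fun n => ?_, fun C hC hCΩ => ?_⟩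
  · exact Set.image_mono (f := ((↑) : Ω → X)) (κ.subset hmn)
  · rintro _ ⟨x, -, rfl⟩
    exact x.2
  · obtain ⟨n, hn⟩ := κ.exists_superset_of_isCompact
      (IsInducing.subtypeVal.isCompact_preimage_iff (by simpa using hCΩ) |>.2 hC)
    exact ⟨n, fun x hx => ⟨⟨x, hCΩ hx⟩, hn hx, rfl⟩⟩

theorem TopologicalSpace.Opens.diff_compact_nonempty {X : Type*} [TopologicalSpace X]
    [T2Space X] [PreconnectedSpace X] [NoncompactSpace X] {Ω : Opens X}
    (hΩ : (Ω : Set X).Nonempty) {K : Set X} (hK : IsCompact K) (hKΩ : K ⊆ Ω) :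
    ((Ω : Set X) \ K).Nonempty := by
  by_contra hne
  have hKeq : K = Ω := hKΩ.antisymm (Set.sdiff_eq_empty.1 (Set.not_nonempty_iff_eq_empty.1 hne))
  have huniv : K = Set.univ :=
    IsClopen.eq_univ ⟨hK.isClosed, hKeq ▸ Ω.isOpen⟩ (hKeq ▸ hΩ)
  exact hK.ne_univ huniv

/-! ### Spaces of test functions are strict (LF)-spaces -/

namespace TestFunction

variable {E F : Type*} [NormedAddCommGroup E] [NormedSpace ℝ E] [NormedAddCommGroup F]
  [NormedSpace ℝ F] {n : ℕ∞} {Ω : Opens E}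

variable (n F) in
/-- The subspace of `𝓓^{n}(Ω, F)` of functions supported in the compact set `K ⊆ Ω`, as the range of
the inclusion of `𝓓^{n}_{K}(E, F)`. -/
noncomputable def supportedIn {K : Compacts E} (hK : (K : Set E) ⊆ Ω) :
    Submodule ℝ 𝓓^{n}(Ω, F) :=
  LinearMap.range (ofSupportedInCLM ℝ hK : 𝓓^{n}_{K}(E, F) →L[ℝ] 𝓓^{n}(Ω, F)).toLinearMap

variable (n F) in
/-- The identification of `𝓓^{n}_{K}(E, F)` with a subspace of `𝓓^{n}(Ω, F)`. -/
noncomputable def supportedInEquiv {K : Compacts E} (hK : (K : Set E) ⊆ Ω) :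
    𝓓^{n}_{K}(E, F) ≃ₗ[ℝ] supportedIn F n hK :=
  LinearEquiv.ofInjective _ fun _ _ hfg =>
    ContDiffMapSupportedIn.ext fun x => congrArg (fun h : 𝓓^{n}(Ω, F) => h x) hfg

variable (n F) in
/-- The topology of uniform convergence of the derivatives, transported from `𝓓^{n}_{K}(E, F)`. It is
not declared as an instance, since the subspace also inherits a topology from `𝓓^{n}(Ω, F)`. -/
@[reducible]
noncomputable def supportedInTopology {K : Compacts E} (hK : (K : Set E) ⊆ Ω) :
    TopologicalSpace (supportedIn F n hK) :=
  ContDiffMapSupportedIn.topologicalSpace.induced (supportedInEquiv F n hK).symm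

@[simp]
theorem supportedInEquiv_apply {K : Compacts E} (hK : (K : Set E) ⊆ Ω) (f : 𝓓^{n}_{K}(E, F))
    (x : E) : (supportedInEquiv F n hK f : 𝓓^{n}(Ω, F)) x = f x := rfl

theorem mem_supportedIn {K : Compacts E} (hK : (K : Set E) ⊆ Ω) {f : 𝓓^{n}(Ω, F)} :
    f ∈ supportedIn F n hK ↔ Function.support f ⊆ K := by
  constructor
  · rintro ⟨g, rfl⟩
    exact g.support_subset
  · intro h
    exact ⟨.of_support_subset f.contDiff h, by ext; rfl⟩

theorem supportedIn_mono {K₁ K₂ : Compacts E} (h : K₁ ≤ K₂) (h₁ : (K₁ : Set E) ⊆ Ω)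
    (h₂ : (K₂ : Set E) ⊆ Ω) : supportedIn F n h₁ ≤ supportedIn F n h₂ := fun _ hf =>
  (mem_supportedIn h₂).2 (((mem_supportedIn h₁).1 hf).trans h)

theorem supportedInTopology_eq_induced {K₁ K₂ : Compacts E} (h : K₁ ≤ K₂) (h₁ : (K₁ : Set E) ⊆ Ω)
    (h₂ : (K₂ : Set E) ⊆ Ω) :
    supportedInTopology F n h₁ = (supportedInTopology F n h₂).induced
      (Submodule.inclusion (supportedIn_mono h h₁ h₂)) := by
  rw [supportedInTopology, supportedInTopology, induced_compose,
    (ContDiffMapSupportedIn.isInducing_monoCLM h).eq_induced, induced_compose]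
  congr 1
  funext f
  obtain ⟨g, rfl⟩ := (supportedInEquiv F n h₁).surjective f
  refine (supportedInEquiv F n h₂).injective ?_
  ext x
  simp [h]

theorem isInductiveLimit_supportedIn {K : ℕ → Compacts E} (hmono : Monotone K)
    (hK : ∀ k, (K k : Set E) ⊆ Ω) (hcover : ∀ C : Set E, IsCompact C → C ⊆ Ω → ∃ k, C ⊆ K k) :
    IsInductiveLimit (fun k => supportedIn F n (hK k)) (fun k => supportedInTopology F n (hK k))
      (topologicalSpace Ω F n) where
  mono k := supportedIn_mono (hmono k.le_succ) _ _
  step_le k := (supportedInTopology_eq_induced (hmono k.le_succ) (hK k) (hK (k + 1))).le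
  cover f := by
    obtain ⟨k, hk⟩ := hcover _ f.hasCompactSupport f.tsupport_subset
    exact ⟨k, (mem_supportedIn (hK k)).2 ((subset_tsupport f).trans hk)⟩
  locallyConvex := ⟨inferInstance, inferInstance, inferInstance⟩
  le_induced k := by
    let := supportedInTopology F n (hK k)
    rw [← continuous_iff_le_induced]
    have h1 : Continuous (supportedInEquiv F n (hK k)).symm := continuous_induced_dom
    refine ((continuous_ofSupportedIn (hK k)).comp h1).congr fun f => ?_
    exact congrArg Subtype.val ((supportedInEquiv F n (hK k)).apply_symm_apply f)
  finest t' ht' hle := by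
    have := ht'.isTopologicalAddGroup
    have := ht'.continuousSMul
    have := ht'.locallyConvexSpace
    rw [topologicalSpace_le_iff, originalTop, iSup₂_le_iff]
    intro C hC
    obtain ⟨k, hk⟩ := hcover C C.isCompact hC
    rw [← continuous_iff_coinduced_le]
    let := supportedInTopology F n (hK k)
    have h1 : Continuous (supportedIn F n (hK k)).subtype := continuous_iff_le_induced.2 (hle k)
    have h2 : Continuous (supportedInEquiv F n (hK k)) := by
      refine continuous_induced_rng.2 (continuous_id.congr fun _ => ?_)
      simp
    refine ((h1.comp h2).comp (ContDiffMapSupportedIn.monoCLM ℝ :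
      𝓓^{n}_{C}(E, F) →L[ℝ] 𝓓^{n}_{K k}(E, F)).continuous).congr fun f => ?_
    ext x
    have : C ≤ K k := hk
    simp [this]

theorem exists_support_not_subset [FiniteDimensional ℝ E] [Nontrivial E] [Nontrivial F]
    (hΩ : (Ω : Set E).Nonempty) {K : Set E} (hK : IsCompact K) (hKΩ : K ⊆ Ω) :
    ∃ f : 𝓓^{n}(Ω, F), ¬ Function.support f ⊆ K := by
  have : NoncompactSpace E := NormedSpace.noncompactSpace ℝ E
  obtain ⟨x, hx, hxK⟩ := Opens.diff_compact_nonempty hΩ hK hKΩ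
  obtain ⟨φ, hφs, hφc, hφ, -, hφx⟩ :=
    exists_contDiff_tsupport_subset (n := n) (Ω.isOpen.mem_nhds hx)
  obtain ⟨y, hy⟩ := exists_ne (0 : F)
  refine ⟨⟨fun z => φ z • y, hφ.smul contDiff_const, hφc.smul_right,
    (tsupport_smul_subset_left φ _).trans hφs⟩, fun h => hxK (h ?_)⟩
  simp [hφx, hy]

theorem isStrictLF [FiniteDimensional ℝ E] [Nontrivial E] [Nontrivial F] [CompleteSpace F]
    (hΩ : (Ω : Set E).Nonempty) : IsStrictLF 𝓓^{n}(Ω, F) := by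
  have : ProperSpace E := FiniteDimensional.proper ℝ E
  obtain ⟨K, hmono, hK, hcover⟩ := Ω.exists_compacts_exhaustion
  have hSmono : Monotone fun k => supportedIn F n (hK k) :=
    fun k l hkl => supportedIn_mono (hmono hkl) _ _
  obtain ⟨φ, hφ, hSφ⟩ := hSmono.exists_strictMono_comp fun k => by
    obtain ⟨f, hf⟩ := exists_support_not_subset (F := F) (n := n) hΩ (K k).isCompact (hK k)
    obtain ⟨l, hl⟩ := hcover _ f.hasCompactSupport f.tsupport_subset
    have hfl : f ∈ supportedIn F n (hK l) := (mem_supportedIn _).2 ((subset_tsupport f).trans hl)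
    have hfk : f ∉ supportedIn F n (hK k) := fun h => hf ((mem_supportedIn _).1 h)
    refine ⟨l, lt_of_le_not_ge ?_ fun h => hfk (h hfl)⟩
    exact hSmono ((le_total k l).resolve_right fun h => hfk (hSmono h hfl))
  refine ⟨fun k => supportedIn F n (hK (φ k)), fun k => supportedInTopology F n (hK (φ k)),
    isInductiveLimit_supportedIn (hmono.comp hφ.monotone) (fun k => hK (φ k)) fun C hC hCΩ => ?_,
    fun k => ?_, fun k => hSφ k.lt_succ_self, fun k => ?_⟩
  · obtain ⟨k, hk⟩ := hcover C hC hCΩ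
    exact ⟨k, hk.trans (hmono (hφ.le_apply))⟩
  · exact ContDiffMapSupportedIn.isFrechetTopology.induced_linearEquiv _
  · exact supportedInTopology_eq_induced (hmono (hφ.monotone k.le_succ)) _ _

end TestFunction

end

theorem corollary3p13 :
    (∀ (E : Type*) [AddCommGroup E] [Module ℝ E] [TopologicalSpace E],
      IsStrictLF E → ¬ FiniteDimensional ℝ E → ¬ IsGDS E) ∧
    (∀ (N : ℕ) (Ω : TopologicalSpace.Opens (EuclideanSpace ℝ (Fin N))),
      1 ≤ N → (Ω : Set (EuclideanSpace ℝ (Fin N))).Nonempty →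
      (∀ m : ℕ, IsStrictLF 𝓓^{(m : ℕ∞)}(Ω, ℝ) ∧ ¬ FiniteDimensional ℝ 𝓓^{(m : ℕ∞)}(Ω, ℝ) ∧
        ¬ IsGDS 𝓓^{(m : ℕ∞)}(Ω, ℝ)) ∧
      (IsStrictLF 𝓓(Ω, ℝ) ∧ ¬ FiniteDimensional ℝ 𝓓(Ω, ℝ) ∧ ¬ IsGDS 𝓓(Ω, ℝ))) := by
  refine ⟨fun E _ _ _ hE _ => hE.not_isGDS, fun N Ω hN hΩ => ?_⟩
  have : Nonempty (Fin N) := ⟨⟨0, hN⟩⟩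
  have key : ∀ n : ℕ∞, IsStrictLF 𝓓^{n}(Ω, ℝ) := fun n => TestFunction.isStrictLF hΩ
  exact ⟨fun m => ⟨key m, (key m).not_finiteDimensional, (key m).not_isGDS⟩,
    key ⊤, (key ⊤).not_finiteDimensional, (key ⊤).not_isGDS⟩
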